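/- Let $n_1,n_2,n_3,n_4$ be nonnegative integers with $\gcd(n_1,n_2,n_3,n_4)=1$ such that no $n_i$ lies in the submonoid of $\mathbb N=\{0,1,2,\dots\}$ generated by the other three, and let $S=\langle n_1,n_2,n_3,n_4\rangle=\{a_1n_1+\dots+a_4n_4 : a_i\in\mathbb N\}$ be the numerical semigroup of embedding dimension $4$ that they minimally generate. (1) Let $k$ be any field, let $k[t^{n_1},t^{n_2},t^{n_3},t^{n_4}]\subseteq k[t]$ be the coordinate ring of the monomial curve $\mathcal C\subseteq\mathbb A^4$ with parametrization $(t^{n_1},t^{n_2},t^{n_3},t^{n_4})$, and let $R$ be the local ring of $\mathcal C$ at the origin, with residue field $\kappa$. Write $r(R)=\dim_\kappa \operatorname{Ext}^d_R(\kappa,R)$, where $d$ is the depth of $R$, for its Cohen–Macaulay type, $\overline R$ for its normalization and $R:\overline R$ for the conductor. If $R$ is almost Gorenstein, that is, if $$\ell_R(\overline R/R)=\ell_R\bigl(R/(R:\overline R)\bigr)+r(R)-1,$$ then $r(R)\le 3$. (2) Let $F(S)=\max(\mathbb Z\setminus S)$ be the Frobenius number of $S$ and let $PF(S)=\{x\in\mathbb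 Z\setminus S : x+s\in S \text{ for all } s\in S\setminus\{0\}\}$ be the set of its pseudo-Frobenius numbers. If $S$ is almost symmetric, that is, if for every $x\in\mathbb Z\setminus S$ with $F(S)-x\notin S$ we have $\{x,F(S)-x\}\subseteq PF(S)$, then $S$ has at most $3$ pseudo-Frobenius numbers: $|PF(S)|\le 3$. -/

import Mathlib

open CategoryTheory

universe u

/-! ### Numerical semigroups -/

/-- The submonoid `⟨n₁, …, n_e⟩` of `ℕ`; it is a numerical semigroup when `gcd (n₁, …, n_e) = 1`. -/
def numSemigroup {e : ℕ} (n : Fin e → ℕ) : AddSubmonoid ℕ :=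
  AddSubmonoid.closure (Set.range n)

/-- `n₁, …, n_e` is a minimal generating system: no generator lies in the submonoid generated by
the others. -/
def IsMinimalGenSystem {e : ℕ} (n : Fin e → ℕ) : Prop :=
  ∀ i, n i ∉ AddSubmonoid.closure (n '' {j | j ≠ i})

namespace NumSemigroup

/-- `S ⊆ ℕ` regarded as a subset of `ℤ`. -/
def intSet (S : AddSubmonoid ℕ) : Set ℤ := (fun a : ℕ => (a : ℤ)) '' (S : Set ℕ)

/-- The Frobenius number `F(S) = max (ℤ \ S)`. If `ℕ \ S` is finite, then `ℤ \ S` is nonempty and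
bounded above, so that the supremum is a maximum. -/
noncomputable def frobenius (S : AddSubmonoid ℕ) : ℤ := sSup (intSet S)ᶜ

/-- The set `PF(S)` of pseudo-Frobenius numbers. -/
def pseudoFrobenius (S : AddSubmonoid ℕ) : Set ℤ :=
  {x | x ∉ intSet S ∧ ∀ s ∈ S, s ≠ 0 → x + (s : ℤ) ∈ intSet S}

/-- The type `t(S)`, the number of pseudo-Frobenius numbers. -/
noncomputable def type (S : AddSubmonoid ℕ) : ℕ∞ := (pseudoFrobenius S).encard

/-- `S` is almost symmetric: for every `x ∈ ℤ \ S` with `F(S) - x ∉ S`, both `x` and `F(S) - x`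
are pseudo-Frobenius numbers. -/
def IsAlmostSymmetric (S : AddSubmonoid ℕ) : Prop :=
  ∀ x : ℤ, x ∉ intSet S → frobenius S - x ∉ intSet S →
    x ∈ pseudoFrobenius S ∧ frobenius S - x ∈ pseudoFrobenius S

end NumSemigroup

/-! ### Cohen–Macaulay type and almost Gorenstein local rings -/

section LocalRing

variable (R : Type u) [CommRing R] [IsLocalRing R]

/-- `Ext^i_R(κ, R)`, where `κ` is the residue field of `R`. -/
abbrev ResidueExt (i : ℕ) : Type u :=
  Abelian.Ext.{u} (ModuleCat.of R (IsLocalRing.ResidueField R)) (ModuleCat.of R R) i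

/-- The depth of a Noetherian local ring: the least `i` with `Ext^i_R(κ, R) ≠ 0`. -/
noncomputable def localDepth : ℕ := sInf {i | Nontrivial (ResidueExt R i)}

/-- The (Cohen–Macaulay) type `r(R) = dim_κ Ext^d_R(κ, R)`, `d = depth R`. As this module is killed
by the maximal ideal, its dimension over `κ` is its length over `R`. -/
noncomputable def cohenMacaulayType : ℕ∞ := Module.length R (ResidueExt R (localDepth R))

/-- The integral closure `R̄` of `R` in its total ring of fractions. -/
abbrev Normalization : Subalgebra R (FractionRing R) := integralClosure R (FractionRing R)

/-- The `R`-module `R̄ / R`. -/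
abbrev NormalizationQuotient : Type u :=
  Normalization R ⧸ LinearMap.range (Algebra.linearMap R (Normalization R))

/-- The conductor `R : R̄ = {x | x R̄ ⊆ R}`, the annihilator of `R̄ / R`. -/
noncomputable abbrev conductorIdeal : Ideal R := Module.annihilator R (NormalizationQuotient R)

/-- The definition of Barucci and Fröberg: a one-dimensional analytically unramified local ring `R`
is almost Gorenstein if `ℓ(R̄ / R) = ℓ(R / (R : R̄)) + r(R) - 1`. (In general `≥` holds. The
condition is equivalent to `𝔪 ω ⊆ 𝔪` for a canonical ideal `R ⊆ ω ⊆ R̄`.) -/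
def IsAlmostGorenstein : Prop :=
  Module.length R (NormalizationQuotient R) + 1 =
    Module.length R (R ⧸ conductorIdeal R) + cohenMacaulayType R

end LocalRing

/-! ### Monomial curves -/

namespace MonomialCurve

variable (k : Type u) [Field k] {e : ℕ} (n : Fin e → ℕ)

/-- The coordinate ring `k[t^{n₁}, …, t^{n_e}] ⊆ k[t]` of the monomial curve in affine `e`-space
with parametrization `(t^{n₁}, …, t^{n_e})`. -/
noncomputable abbrev coordinateRing : Subalgebra k (Polynomial k) :=
  Algebra.adjoin k (Set.range fun i => (Polynomial.X : Polynomial k) ^ n i)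

/-- The ideal of the origin `t = 0`. -/
noncomputable def originIdeal : Ideal (coordinateRing k n) :=
  RingHom.ker ((Polynomial.constantCoeff (R := k)).comp
    (coordinateRing k n).toSubring.subtype)

instance originIdeal_isPrime : (originIdeal k n).IsPrime := RingHom.ker_isPrime _

/-- The local ring of the monomial curve at the origin. -/
abbrev localRing : Type u := Localization.AtPrime (originIdeal k n)

end MonomialCurve

/-! ### The counting argument behind the bound -/

namespace NumSemigroup

/-! For (2), let `P` be the set of pseudo-Frobenius numbers other than `F`. Almost symmetry makes
`P` stable under `f ↦ F - f`, so it suffices to show `|P| ≤ 2`, which is done by double counting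
(`card_le_two_of_symmetric`). Among the `12|P|` triples `(f, i, j)` with `i ≠ j`, let `E` consist of
those with `f + n i - n j ∈ S`, and `C` of those with `f + n i - n j ∈ P`. The involution `(f, i, j)
↦ (F - f, j, i)` carries `E` to a set disjoint from `E`, since otherwise `F ∈ S`; both are disjoint
from `C`. Hence `2|E| + |C| ≤ 12|P|`.

Conversely, regard `E` as edges `(f, i) → j`. Each of the `4|P|` vertices has an edge, because every
generator in a factorization of `f + n i` gives one. If `U` is the set of vertices with exactly one
edge, then `8|P| ≤ |E| + |U|`. When that edge goes to `j`, `f + n i` is a multiple of `n j`, and it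
is the same multiple for all such vertices. Two of them therefore differ by an element of `C`, and
`2|U| ≤ 8 + |C|` follows. Together, `16|P| ≤ 12|P| + 8`.

For (1), expansion at the origin embeds `R` in `k⟦t⟧`, as the fractions of elements of `R` that are
power series supported in `S`. Reading off coefficients gives three inequalities: `ℓ(R̄/R)` is at
least the number of gaps, `ℓ(R/(R : R̄))` is at most the number of elements of `S` below `F`, and
`r(R) ≤ t(S)`. Inserted in the almost Gorenstein equation they force `S` to be almost symmetric, and
(2) together with `r(R) ≤ t(S)` finishes the proof. -/

/-- In a set of integers generated by four elements `n i`, let `P` be a finite set of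
non-members that is stable under `f ↦ F - f` for some non-member `F`, and whose translates by the
generators are nonzero members. Then `P` has at most two elements. -/
theorem card_le_two_of_symmetric {T : AddSubmonoid ℤ} {n : Fin 4 → ℤ}
    (hnT : ∀ i, n i ∈ T)
    (hT : ∀ x ∈ T, ∃ c : Fin 4 → ℕ, x = ∑ i, (c i : ℤ) * n i)
    {F : ℤ} (hF : F ∉ T) {P : Finset ℤ} (hP : ∀ f ∈ P, f ∉ T)
    (hsymm : ∀ f ∈ P, F - f ∈ P) (hadd : ∀ f ∈ P, ∀ i, f + n i ∈ T)
    (hne : ∀ f ∈ P, ∀ i, f + n i ≠ 0) : P.card ≤ 2 := by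
  classical
  -- all triples `(f, i, j)` with `i ≠ j`
  let W : Finset (ℤ × Fin 4 × Fin 4) := P ×ˢ (Finset.univ : Finset (Fin 4)).offDiag
  let E := W.filter fun w => w.1 + n w.2.1 - n w.2.2 ∈ T
  let E' := W.filter fun w => F - w.1 + n w.2.2 - n w.2.1 ∈ T
  let C := W.filter fun w => w.1 + n w.2.1 - n w.2.2 ∈ P
  have memW : ∀ w, w ∈ W ↔ w.1 ∈ P ∧ w.2.1 ≠ w.2.2 := by
    intro w; simp [W]
  have cardW : W.card = 12 * P.card := by
    simp [W, Finset.card_product, Finset.offDiag_card, mul_comm]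
  have hEE' : E'.card = E.card := by
    refine Finset.card_bij' (fun w _ => (F - w.1, w.2.2, w.2.1))
      (fun w _ => (F - w.1, w.2.2, w.2.1)) ?_ ?_ ?_ ?_
    · intro w hw
      simp only [E', E, Finset.mem_filter, memW] at hw ⊢
      exact ⟨⟨hsymm _ hw.1.1, hw.1.2.symm⟩, hw.2⟩
    · intro w hw
      simp only [E', E, Finset.mem_filter, memW] at hw ⊢
      exact ⟨⟨hsymm _ hw.1.1, hw.1.2.symm⟩, by simpa using hw.2⟩
    · intro w _; simp
    · intro w _; simp
  have d1 : Disjoint E E' := by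
    refine Finset.disjoint_filter.2 fun w _ h1 h2 => hF ?_
    have := T.add_mem h1 h2
    have e : w.1 + n w.2.1 - n w.2.2 + (F - w.1 + n w.2.2 - n w.2.1) = F := by ring
    rwa [e] at this
  have d2 : Disjoint (E ∪ E') C := by
    rw [Finset.disjoint_union_left]
    refine ⟨Finset.disjoint_filter.2 fun w _ h1 h2 => hP _ h2 h1,
      Finset.disjoint_filter.2 fun w _ h1 h2 => hP _ (hsymm _ h2) ?_⟩
    have e : F - w.1 + n w.2.2 - n w.2.1 = F - (w.1 + n w.2.1 - n w.2.2) := by ring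
    rwa [e] at h1
  have hcount : 2 * E.card + C.card ≤ 12 * P.card := by
    have h : ((E ∪ E') ∪ C).card ≤ W.card :=
      Finset.card_le_card (by
        refine Finset.union_subset (Finset.union_subset ?_ ?_) ?_ <;> exact Finset.filter_subset _ _)
    rw [Finset.card_union_of_disjoint d2, Finset.card_union_of_disjoint d1, hEE', cardW] at h
    omega
  -- outgoing edges of `(f, i)`
  let out : ℤ × Fin 4 → Finset (Fin 4) := fun v =>
    Finset.univ.filter fun j => v.2 ≠ j ∧ v.1 + n v.2 - n j ∈ T
  let V : Finset (ℤ × Fin 4) := P ×ˢ Finset.univ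
  have memV : ∀ v, v ∈ V ↔ v.1 ∈ P := by intro v; simp [V]
  have cardV : V.card = 4 * P.card := by simp [V, Finset.card_product, mul_comm]
  have hEsum : E.card = ∑ v ∈ V, (out v).card := by
    rw [← Finset.card_sigma]
    refine Finset.card_bij' (fun w _ => ⟨(w.1, w.2.1), w.2.2⟩) (fun s _ => (s.1.1, s.1.2, s.2))
      ?_ ?_ ?_ ?_
    · intro w hw
      simp only [E, Finset.mem_filter, memW] at hw
      simp [out, memV, hw]
    · intro s hs
      simp only [Finset.mem_sigma, memV, out, Finset.mem_filter, Finset.mem_univ, true_and] at hs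
      simp [E, memW, hs]
    · intro w _; rfl
    · intro s _; rfl
  -- Removing one copy of a generator `n j` that occurs in a factorization of `f + n i` stays in
  -- `T`. The generator `n i` itself cannot occur, as `f ∉ T`.
  have edge_of_coeff : ∀ v ∈ V, ∀ c : Fin 4 → ℕ, v.1 + n v.2 = ∑ i, (c i : ℤ) * n i →
      ∀ j, c j ≠ 0 → j ∈ out v := by
    intro v hv c hc j hj
    have hmem : v.1 + n v.2 - n j ∈ T := by
      have : v.1 + n v.2 - n j = ∑ i, (((c - Pi.single j 1 : Fin 4 → ℕ) i : ℕ) : ℤ) * n i := by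
        have h2 : ∀ i, (((c - Pi.single j 1 : Fin 4 → ℕ) i : ℕ) : ℤ) * n i =
            (c i : ℤ) * n i - if i = j then n j else 0 := by
          intro i
          by_cases hij : i = j
          · subst hij
            obtain ⟨m, hm⟩ := Nat.exists_eq_succ_of_ne_zero hj
            simp [hm]; ring
          · simp [hij]
        simp only [h2, Finset.sum_sub_distrib, Finset.sum_ite_eq', Finset.mem_univ, if_true, hc]
      rw [this]
      exact T.sum_mem fun i _ => by
        rw [← nsmul_eq_mul]; exact T.nsmul_mem (hnT i) _
    simp only [out, Finset.mem_filter, Finset.mem_univ, true_and]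
    refine ⟨fun h => hP _ ((memV v).1 hv) ?_, hmem⟩
    rw [← h] at hmem
    simpa using hmem
  have out_pos : ∀ v ∈ V, 1 ≤ (out v).card := by
    intro v hv
    obtain ⟨c, hc⟩ := hT _ (hadd _ ((memV v).1 hv) v.2)
    have : ∃ j, c j ≠ 0 := by
      by_contra! h
      exact hne _ ((memV v).1 hv) v.2 (by rw [hc]; simp [h])
    obtain ⟨j, hj⟩ := this
    exact Finset.card_pos.2 ⟨j, edge_of_coeff v hv c hc j hj⟩
  let U := V.filter fun v => (out v).card = 1
  have hU : 2 * V.card ≤ E.card + U.card := by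
    rw [hEsum, Finset.card_filter, ← Finset.sum_add_distrib, mul_comm, ← smul_eq_mul,
      ← Finset.sum_const]
    refine Finset.sum_le_sum fun v hv => ?_
    have := out_pos v hv
    split_ifs <;> omega
  let u : Fin 4 → Finset (ℤ × Fin 4) := fun j => V.filter fun v => out v = {j}
  have hUu : U.card = ∑ j, (u j).card := by
    have : U = Finset.univ.biUnion u := by
      ext v
      simp only [U, u, Finset.mem_filter, Finset.mem_biUnion, Finset.mem_univ, true_and,
        Finset.card_eq_one]
      tauto
    rw [this, Finset.card_biUnion]
    intro i _ j _ hij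
    refine Finset.disjoint_filter.2 fun v _ h1 h2 => hij ?_
    rw [h1] at h2
    simpa using h2
  have u_eq : ∀ j, ∀ v ∈ u j, j ≠ v.2 ∧ ∃ a : ℕ, v.1 + n v.2 = a * n j := by
    intro j v hv
    obtain ⟨hvV, hv⟩ := Finset.mem_filter.1 hv
    have hj : j ∈ out v := by simp [hv]
    refine ⟨fun h => (Finset.mem_filter.1 hj).2.1 h.symm, ?_⟩
    obtain ⟨c, hc⟩ := hT _ (hadd _ ((memV v).1 hvV) v.2)
    refine ⟨c j, ?_⟩
    rw [hc]
    refine Finset.sum_eq_single j (fun i _ hi => ?_) (by simp)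
    by_contra h
    have := edge_of_coeff v hvV c hc i (by rintro h0; simp [h0] at h)
    rw [hv] at this
    exact hi (by simpa using this)
  -- If `b < a`, then `f + n i` is the sum of `f' + n i'`, at least one `n j` and further copies of
  -- `n j`. As `f' + n j ∈ T`, subtracting `n i'` leaves an element of `T`: either `f ∈ T`, or there
  -- is a second edge, to `i' ≠ j`.
  have u_not_lt : ∀ j, ∀ v ∈ u j, ∀ w ∈ u j, ∀ a b : ℕ, v.1 + n v.2 = a * n j →
      w.1 + n w.2 = b * n j → ¬ b < a := by
    intro j v hv w hw a b ha hb hlt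
    have hvV := (Finset.mem_filter.1 hv).1
    have hwV := (Finset.mem_filter.1 hw).1
    have key : v.1 + n v.2 - n w.2 ∈ T := by
      have e : v.1 + n v.2 - n w.2 = (w.1 + n j) + (a - b - 1 : ℕ) • n j := by
        rw [nsmul_eq_mul, Nat.cast_sub (by omega), Nat.cast_sub hlt.le]
        push_cast
        linear_combination ha - hb
      rw [e]
      exact T.add_mem (hadd _ ((memV w).1 hwV) j) (T.nsmul_mem (hnT j) _)
    by_cases h : v.2 = w.2
    · rw [h] at key
      exact hP _ ((memV v).1 hvV) (by simpa using key)
    · have : w.2 ∈ out v := by simp [out, h, key]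
      rw [(Finset.mem_filter.1 hv).2] at this
      exact (u_eq j w hw).1 (Finset.mem_singleton.1 this).symm
  have u_const : ∀ j, ∀ v ∈ u j, ∀ w ∈ u j, v.1 + n v.2 = w.1 + n w.2 := by
    intro j v hv w hw
    obtain ⟨a, ha⟩ := (u_eq j v hv).2
    obtain ⟨b, hb⟩ := (u_eq j w hw).2
    have h1 := u_not_lt j v hv w hw a b ha hb
    have h2 := u_not_lt j w hw v hv b a hb ha
    have : a = b := by omega
    rw [ha, hb, this]
  -- Two distinct vertices `(f, i)`, `(f', i')` of `u j` satisfy `f + n i - n i' = f' ∈ P`, so `(f,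
  -- i, i')` lies in `C`.
  have hC : ∑ j, (u j).offDiag.card ≤ C.card := by
    rw [← Finset.card_sigma]
    refine Finset.card_le_card_of_injOn (fun s => (s.2.1.1, s.2.1.2, s.2.2.2)) ?_ ?_
    · rintro ⟨j, v, w⟩ hs
      simp only [Finset.coe_sigma, Set.mem_sigma_iff, Finset.mem_coe, Finset.mem_univ, true_and,
        Finset.mem_offDiag] at hs
      obtain ⟨hv, hw, hvw⟩ := hs
      have hvV := (memV v).1 (Finset.mem_filter.1 hv).1
      have hwV := (memV w).1 (Finset.mem_filter.1 hw).1
      have e := u_const j v hv w hw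
      simp only [C, Finset.coe_filter, Set.mem_ofPred_eq, memW]
      refine ⟨⟨hvV, fun h => hvw ?_⟩, ?_⟩
      · rw [h] at e
        exact Prod.ext (by linarith) h
      · rw [e]; simpa using hwV
    · rintro ⟨j, v, w⟩ hs ⟨j', v', w'⟩ hs' h
      simp only [Finset.coe_sigma, Set.mem_sigma_iff, Finset.mem_coe, Finset.mem_univ, true_and,
        Finset.mem_offDiag] at hs hs'
      simp only [Prod.mk.injEq] at h
      have hvv : v = v' := Prod.ext h.1 h.2.1
      subst hvv
      have hj : j = j' := by
        have h1 := (Finset.mem_filter.1 hs.1).2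
        rw [(Finset.mem_filter.1 hs'.1).2] at h1
        simpa using h1.symm
      subst hj
      have e1 := u_const j v hs.1 w hs.2.1
      have e2 := u_const j v hs.1 w' hs'.2.1
      have hww : w = w' := Prod.ext (by rw [h.2.2] at e1; linarith) h.2.2
      rw [hww]
  -- This is `(m - 1)(m - 2) ≥ 0`; summed over the four values of `j` it produces the constant `8`.
  have hfin : ∀ m : ℕ, 2 * m ≤ 2 + (m * m - m) := by
    intro m
    rcases Nat.lt_or_ge m 3 with h | h
    · interval_cases m <;> simp
    · have : 3 * m ≤ m * m := Nat.mul_le_mul_right m h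
      omega
  have hs : 2 * U.card ≤ 8 + C.card := by
    calc 2 * U.card = ∑ j, 2 * (u j).card := by rw [hUu, Finset.mul_sum]
      _ ≤ ∑ j, (2 + (u j).offDiag.card) :=
        Finset.sum_le_sum fun j _ => by rw [Finset.offDiag_card]; exact hfin _
      _ = 8 + ∑ j, (u j).offDiag.card := by rw [Finset.sum_add_distrib]; simp
      _ ≤ 8 + C.card := by omega
  -- `16|P| ≤ 2|E| + 2|U| ≤ 2|E| + |C| + 8 ≤ 12|P| + 8`.
  omega

end NumSemigroup

/-! ### Gaps, pseudo-Frobenius numbers and almost symmetry -/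

namespace NumSemigroup

section Basic

variable {S : AddSubmonoid ℕ}

@[simp]
theorem natCast_mem_intSet {a : ℕ} : (a : ℤ) ∈ intSet S ↔ a ∈ S := by
  simp [intSet]

theorem nonneg_of_mem_intSet {x : ℤ} (hx : x ∈ intSet S) : 0 ≤ x := by
  obtain ⟨a, -, rfl⟩ := hx
  simp

theorem zero_mem_intSet : (0 : ℤ) ∈ intSet S := ⟨0, S.zero_mem, rfl⟩

theorem add_mem_intSet {x y : ℤ} (hx : x ∈ intSet S) (hy : y ∈ intSet S) : x + y ∈ intSet S := by
  obtain ⟨a, ha, rfl⟩ := hx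
  obtain ⟨b, hb, rfl⟩ := hy
  exact ⟨a + b, S.add_mem ha hb, by simp⟩

theorem add_mem_of_mem_pseudoFrobenius {x y : ℤ} (hx : x ∈ pseudoFrobenius S)
    (hy : y ∈ intSet S) (hy0 : y ≠ 0) : x + y ∈ intSet S := by
  obtain ⟨b, hb, rfl⟩ := hy
  exact hx.2 b hb (by simpa using hy0)

theorem isGreatest_frobenius (hS : ∃ N, ∀ m ≥ N, m ∈ S) :
    IsGreatest (intSet S)ᶜ (frobenius S) := by
  obtain ⟨N, hN⟩ := hS
  have hb : BddAbove (intSet S)ᶜ := by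
    refine ⟨N, fun x hx => ?_⟩
    by_contra! h
    lift x to ℕ using by omega
    exact hx (natCast_mem_intSet.2 (hN x (by omega)))
  have hne : ((intSet S)ᶜ).Nonempty := ⟨-1, fun h => by simpa using nonneg_of_mem_intSet h⟩
  exact ⟨Int.csSup_mem hne hb, fun x hx => le_csSup hb hx⟩

theorem frobenius_notMem (hS : ∃ N, ∀ m ≥ N, m ∈ S) : frobenius S ∉ intSet S :=
  (isGreatest_frobenius hS).1

theorem mem_intSet_of_frobenius_lt (hS : ∃ N, ∀ m ≥ N, m ∈ S) {x : ℤ} (hx : frobenius S < x) :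
    x ∈ intSet S := by
  by_contra h
  exact absurd ((isGreatest_frobenius hS).2 h) (not_le.2 hx)

theorem frobenius_mem_pseudoFrobenius (hS : ∃ N, ∀ m ≥ N, m ∈ S) :
    frobenius S ∈ pseudoFrobenius S :=
  ⟨frobenius_notMem hS, fun s _ h0 => mem_intSet_of_frobenius_lt hS (by omega)⟩

theorem frobenius_sub_notMem (hS : ∃ N, ∀ m ≥ N, m ∈ S) {f : ℤ} (hf : f ∈ pseudoFrobenius S)
    (hfF : f ≠ frobenius S) : frobenius S - f ∉ intSet S := fun h => frobenius_notMem hS (by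
  simpa using add_mem_of_mem_pseudoFrobenius hf h (sub_ne_zero.2 hfF.symm))

theorem finite_pseudoFrobenius (hS : ∃ N, ∀ m ≥ N, m ∈ S) : (pseudoFrobenius S).Finite := by
  obtain ⟨N, hN⟩ := id hS
  refine (Set.finite_Icc (-(N + 1 : ℤ)) (frobenius S)).subset fun x hx => ⟨?_, ?_⟩
  · have := nonneg_of_mem_intSet (hx.2 (N + 1) (hN _ (by omega)) (by omega))
    push_cast at this
    linarith
  · exact (isGreatest_frobenius hS).2 hx.1

theorem nonneg_of_frobenius_sub_notMem (hS : ∃ N, ∀ m ≥ N, m ∈ S) {f : ℤ}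
    (hf' : frobenius S - f ∉ intSet S) : 0 ≤ f := by
  by_contra! h
  exact hf' (mem_intSet_of_frobenius_lt hS (by linarith))

theorem finite_gaps (hS : ∃ N, ∀ m ≥ N, m ∈ S) : {g : ℕ | g ∉ S}.Finite := by
  obtain ⟨N, hN⟩ := hS
  refine (Set.finite_Iio N).subset fun g hg => ?_
  by_contra h
  exact hg (hN g (by simpa using h))

/-- The gaps contain two disjoint sets: the numbers `F - s` with `s ∈ S`, `s < F`, and the set `L`
of `x ∉ S` with `F - x ∉ S`. Since `L` always contains every pseudo-Frobenius number except `F`, the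
assumed inequality leaves no room for other elements of `L`. -/
theorem isAlmostSymmetric_of_encard_gaps_le (hS : ∃ N, ∀ m ≥ N, m ∈ S)
    (h : {g : ℕ | g ∉ S}.encard + 1 ≤ {s : ℕ | s ∈ S ∧ (s : ℤ) < frobenius S}.encard + type S) :
    IsAlmostSymmetric S := by
  set F := frobenius S
  let G : Set ℤ := (fun a : ℕ => (a : ℤ)) '' {g : ℕ | g ∉ S}
  let A : Set ℤ := (fun s : ℕ => F - s) '' {s : ℕ | s ∈ S ∧ (s : ℤ) < F}
  let L : Set ℤ := {x | x ∉ intSet S ∧ F - x ∉ intSet S}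
  have hGc : G.encard = {g : ℕ | g ∉ S}.encard :=
    Function.Injective.encard_image Nat.cast_injective _
  have hAc : A.encard = {s : ℕ | s ∈ S ∧ (s : ℤ) < F}.encard :=
    Function.Injective.encard_image (fun a b hab => by simpa using hab) _
  have hAL : Disjoint A L := by
    rw [Set.disjoint_left]
    rintro _ ⟨s, hs, rfl⟩ hL
    exact hL.2 (by simpa using hs.1)
  have hsub : A ∪ L ⊆ G := by
    rintro x (⟨s, ⟨hs, hsF⟩, rfl⟩ | hx)
    · refine ⟨(F - s).toNat, fun hm => frobenius_notMem hS ?_, by simp; omega⟩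
      have := add_mem_intSet (natCast_mem_intSet.2 hm) (natCast_mem_intSet.2 hs)
      rwa [Int.toNat_of_nonneg (by omega), sub_add_cancel] at this
    · have := nonneg_of_frobenius_sub_notMem hS hx.2
      lift x to ℕ using this
      exact ⟨x, fun hm => hx.1 (natCast_mem_intSet.2 hm), rfl⟩
  have hGfin : G.Finite := (finite_gaps hS).image _
  have hAfin : A.Finite := hGfin.subset (Set.subset_union_left.trans hsub)
  have hLfin : L.Finite := hGfin.subset (Set.subset_union_right.trans hsub)
  have hPL : pseudoFrobenius S \ {F} ⊆ L := fun x hx =>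
    ⟨hx.1.1, frobenius_sub_notMem hS hx.1 hx.2⟩
  have hcard : A.encard + L.encard ≤ G.encard := by
    rw [← Set.encard_union_eq hAL]
    exact Set.encard_le_encard hsub
  have htype : type S = (pseudoFrobenius S \ {F}).encard + 1 :=
    (Set.encard_sdiff_singleton_add_one (frobenius_mem_pseudoFrobenius hS)).symm
  have hle : L.encard ≤ (pseudoFrobenius S \ {F}).encard := by
    rw [← hGc, ← hAc, htype, ← add_assoc] at h
    have h2 := (add_le_add_left hcard 1).trans h
    rw [ENat.add_le_add_iff_right ENat.one_ne_top, ENat.add_le_add_iff_left] at h2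
    · exact h2
    · exact Set.encard_ne_top_iff.2 hAfin
  have heq := (hLfin.subset hPL).eq_of_subset_of_encard_le hPL hle
  intro x hx hFx
  have h1 : x ∈ L := ⟨hx, hFx⟩
  have h2 : F - x ∈ L := ⟨hFx, by simpa using hx⟩
  rw [← heq] at h1 h2
  exact ⟨h1.1, h2.1⟩

end Basic

section Generators

variable {e : ℕ} {n : Fin e → ℕ}

theorem exists_forall_ge_mem_numSemigroup (hgcd : Finset.univ.gcd n = 1) :
    ∃ N, ∀ m ≥ N, m ∈ numSemigroup n := by
  obtain ⟨N, hN⟩ := Nat.exists_mem_closure_of_ge (Set.range n)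
  have h1 : Nat.setGcd (Set.range n) = 1 := by
    rw [← Nat.dvd_one, ← hgcd]
    exact Finset.dvd_gcd fun i _ => Nat.setGcd_dvd_of_mem ⟨i, rfl⟩
  exact ⟨N, fun m hm => hN m hm (by simp [h1])⟩

theorem gen_mem_numSemigroup (i : Fin e) : n i ∈ numSemigroup n :=
  AddSubmonoid.subset_closure ⟨i, rfl⟩

theorem mem_numSemigroup_iff {x : ℕ} : x ∈ numSemigroup n ↔ ∃ c : Fin e → ℕ, x = ∑ i, c i * n i := by
  constructor
  · intro hx
    induction hx using AddSubmonoid.closure_induction with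
    | mem x hx =>
      obtain ⟨i, rfl⟩ := hx
      exact ⟨Pi.single i 1, by simp [Pi.single_apply]⟩
    | zero => exact ⟨0, by simp⟩
    | add x y _ _ hx hy =>
      obtain ⟨c, rfl⟩ := hx
      obtain ⟨d, rfl⟩ := hy
      exact ⟨c + d, by simp [add_mul, Finset.sum_add_distrib]⟩
  · rintro ⟨c, rfl⟩
    exact sum_mem fun i _ => by
      rw [← smul_eq_mul]; exact AddSubmonoid.nsmul_mem _ (gen_mem_numSemigroup i) _

theorem gen_ne_zero (hmin : IsMinimalGenSystem n) (i : Fin e) : n i ≠ 0 :=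
  fun h => hmin i (by rw [h]; exact zero_mem _)

theorem gen_sub_gen_notMem (hmin : IsMinimalGenSystem n) {i j : Fin e} (hij : i ≠ j) :
    (n j : ℤ) - n i ∉ intSet (numSemigroup n) := by
  rintro ⟨s, hs, hsij⟩
  obtain ⟨c, rfl⟩ := mem_numSemigroup_iff.1 hs
  have h : n j = n i + ∑ k, c k * n k := by
    have : (n j : ℤ) = n i + (∑ k, c k * n k : ℕ) := by simp only at hsij; linarith
    exact_mod_cast this
  by_cases hc : c j = 0
  · refine hmin j ?_
    nth_rw 1 [h]
    refine add_mem (AddSubmonoid.subset_closure ⟨i, hij, rfl⟩) (sum_mem fun k _ => ?_)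
    by_cases hk : k = j
    · subst hk; simp [hc]
    · rw [← smul_eq_mul]
      exact nsmul_mem (AddSubmonoid.subset_closure (Set.mem_image_of_mem n hk)) _
  · have h1 : c j * n j ≤ ∑ k, c k * n k :=
      Finset.single_le_sum (f := fun k => c k * n k) (fun _ _ => Nat.zero_le _) (Finset.mem_univ j)
    have h2 : n j ≤ c j * n j := Nat.le_mul_of_pos_left _ (Nat.pos_of_ne_zero hc)
    have := gen_ne_zero hmin i
    omega

/-- If `f = -n i`, the pseudo-Frobenius property applied to another generator puts `n j - n i` in
`S`, against minimality. -/
theorem add_gen_ne_zero (hmin : IsMinimalGenSystem n) {f : ℤ}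
    (hf : f ∈ pseudoFrobenius (numSemigroup n)) {i j : Fin e} (hij : i ≠ j) : f + n i ≠ 0 := by
  intro h
  refine gen_sub_gen_notMem hmin hij ?_
  have := hf.2 (n j) (gen_mem_numSemigroup j) (gen_ne_zero hmin j)
  rwa [show f = -n i by linarith, neg_add_eq_sub] at this

end Generators

/-- An almost symmetric numerical semigroup of embedding dimension four has type at most three. -/
theorem IsAlmostSymmetric.type_le_three {n : Fin 4 → ℕ} (hgcd : Finset.univ.gcd n = 1)
    (hmin : IsMinimalGenSystem n) (h : IsAlmostSymmetric (numSemigroup n)) :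
    type (numSemigroup n) ≤ 3 := by
  have hS := exists_forall_ge_mem_numSemigroup hgcd
  set S := numSemigroup n
  let T : AddSubmonoid ℤ :=
    { carrier := intSet S
      zero_mem' := zero_mem_intSet
      add_mem' := add_mem_intSet }
  have hfin : (pseudoFrobenius S \ {frobenius S}).Finite := (finite_pseudoFrobenius hS).sdiff
  have hmem : ∀ f, f ∈ hfin.toFinset ↔ f ∈ pseudoFrobenius S ∧ f ≠ frobenius S := by simp
  have hadd : ∀ f ∈ hfin.toFinset, ∀ i, f + n i ∈ T := fun f hf i =>
    ((hmem f).1 hf).1.2 _ (gen_mem_numSemigroup i) (gen_ne_zero hmin i)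
  have hcard : hfin.toFinset.card ≤ 2 := by
    refine card_le_two_of_symmetric (T := T) (n := fun i => (n i : ℤ)) (F := frobenius S)
      (fun i => natCast_mem_intSet.2 (gen_mem_numSemigroup i)) ?_ (frobenius_notMem hS)
      (fun f hf => ((hmem f).1 hf).1.1) ?_ hadd ?_
    · rintro _ ⟨s, hs, rfl⟩
      obtain ⟨c, rfl⟩ := mem_numSemigroup_iff.1 hs
      exact ⟨c, by simp⟩
    · intro f hf
      obtain ⟨hf, hfF⟩ := (hmem f).1 hf
      refine (hmem _).2 ⟨(h f hf.1 (frobenius_sub_notMem hS hf hfF)).2, fun h0 => hf.1 ?_⟩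
      rw [show f = 0 by linarith]
      exact zero_mem_intSet
    · intro f hf i
      have hij : i ≠ i + 1 := by revert i; decide
      exact add_gen_ne_zero hmin ((hmem f).1 hf).1 hij
  have htype : type S = (pseudoFrobenius S \ {frobenius S}).encard + 1 :=
    (Set.encard_sdiff_singleton_add_one (frobenius_mem_pseudoFrobenius hS)).symm
  rw [htype, hfin.encard_eq_coe_toFinset_card]
  exact_mod_cast Nat.succ_le_succ hcard

end NumSemigroup

/-! ### Comparing lengths over `R` and over `k` -/

section Length

variable {k R : Type*} [Field k] [CommRing R] [Algebra k R]

/-- Used for upper bounds on lengths over `R`: a chain of `R`-submodules is a chain of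
`k`-subspaces, and `E` is a `k`-linear quotient of the image of `c`. -/
theorem length_le_length_of_ker_le {N E W : Type*} [AddCommGroup N] [Module R N] [Module k N]
    [IsScalarTower k R N] [AddCommGroup E] [Module R E] [AddCommGroup W] [Module k W]
    (q : N →ₗ[R] E) (hq : Function.Surjective q) (c : N →ₗ[k] W) (hc : ∀ x, c x = 0 → q x = 0) :
    Module.length R E ≤ Module.length k W := by
  let Q := N ⧸ LinearMap.ker q
  have h1 : Module.length R E = Module.length R Q :=
    (q.quotKerEquivOfSurjective hq).length_eq.symm
  have h2 : Module.length R Q ≤ Module.length k Q := by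
    have := Submodule.length_le_length_restrictScalars (R := R) k (⊤ : Submodule R Q)
    rwa [Submodule.restrictScalars_top, Module.length_top, Module.length_top] at this
  let p : (N ⧸ LinearMap.ker c) →ₗ[k] Q :=
    (LinearMap.ker c).liftQ ((LinearMap.ker q).mkQ.restrictScalars k) (fun x hx => by
      simpa [Q] using hc x hx)
  have hp : Function.Surjective p := by
    intro y
    obtain ⟨x, rfl⟩ := (LinearMap.ker q).mkQ_surjective y
    exact ⟨(LinearMap.ker c).mkQ x, by simp [p]⟩
  have h3 := Module.length_le_of_surjective p hp
  rw [c.quotKerEquivRange.length_eq] at h3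
  exact h1.le.trans (h2.trans (h3.trans
    (Module.length_le_of_injective (LinearMap.range c).subtype (Submodule.subtype_injective _))))

/-- By induction along a composition series: each simple factor is the residue field, which is a
quotient of `k` and so has length at most one over `k`. -/
theorem length_le_length_of_residueField [IsLocalRing R]
    (hk : Function.Surjective (algebraMap k (IsLocalRing.ResidueField R)))
    {M : Type*} [AddCommGroup M] [Module R M] [Module k M] [IsScalarTower k R M] :
    Module.length k M ≤ Module.length R M := by
  by_cases hM : Module.length R M = ⊤
  · rw [hM]; exact le_top
  rw [← ne_eq, Module.length_ne_top_iff] at hM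
  rename_i i1 i2 i3 i4
  revert i3 i4
  induction hM with
  | of_subsingleton => intros; simp
  | @of_simple_quotient M _ _ N hs hN ih =>
    intro _ _
    have e1 : Module.length R M = Module.length R N + Module.length R (M ⧸ N) :=
      Module.length_eq_add_of_exact N.subtype N.mkQ (Submodule.subtype_injective _)
        (Submodule.mkQ_surjective _) (LinearMap.exact_subtype_mkQ N)
    have e2 : Module.length k M =
        Module.length k (N.restrictScalars k) + Module.length k (M ⧸ N.restrictScalars k) :=
      Module.length_eq_add_of_exact (N.restrictScalars k).subtype (N.restrictScalars k).mkQ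
        (Submodule.subtype_injective _) (Submodule.mkQ_surjective _)
        (LinearMap.exact_subtype_mkQ _)
    rw [e1, e2]
    refine add_le_add ih ?_
    rw [Module.length_eq_one (R := R) (M := M ⧸ N)]
    obtain ⟨I, hI, ⟨e⟩⟩ := isSimpleModule_iff_quot_maximal.1 hs
    obtain rfl := IsLocalRing.eq_maximalIdeal hI
    have h1 : Module.length k k = 1 := Module.length_eq_one k k
    rw [← h1]
    refine Module.length_le_of_surjective
      ((e.symm.toLinearMap.restrictScalars k).comp (Algebra.linearMap k (IsLocalRing.ResidueField R))) ?_
    exact e.symm.surjective.comp hk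

end Length

/-! ### `Ext¹(κ, R)` as homomorphisms `𝔪 → R` modulo multiplications -/

section Ext

open IsLocalRing Abelian

variable (R : Type u) [CommRing R] [IsLocalRing R]

/-- The exact sequence `0 → 𝔪 → R → κ → 0`. -/
noncomputable abbrev residueSequence : ShortComplex (ModuleCat.{u} R) :=
  ShortComplex.mk (X₁ := ModuleCat.of R (maximalIdeal R)) (X₂ := ModuleCat.of R R)
    (X₃ := ModuleCat.of R (ResidueField R))
    (ModuleCat.ofHom (maximalIdeal R).subtype)
    (ModuleCat.ofHom (Algebra.linearMap R (ResidueField R)))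
    (by
      ext x
      exact (residue_eq_zero_iff (x : R)).2 x.2)

theorem residueSequence_shortExact : (residueSequence R).ShortExact where
  exact := by
    rw [ShortComplex.moduleCat_exact_iff]
    intro x hx
    exact ⟨⟨x, (residue_eq_zero_iff x).1 hx⟩, rfl⟩
  mono_f := (ModuleCat.mono_iff_injective _).2 (Submodule.subtype_injective _)
  epi_g := (ModuleCat.epi_iff_surjective _).2 residue_surjective

/-- The connecting homomorphism `Hom(𝔪, R) → Ext¹(κ, R)`. -/
noncomputable def connectingHom : (maximalIdeal R →ₗ[R] R) →ₗ[R] ResidueExt R 1 where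
  toFun h := (residueSequence_shortExact R).extClass.comp (Ext.mk₀ (ModuleCat.ofHom h)) rfl
  map_add' f g := by
    rw [ModuleCat.ofHom_add, Ext.mk₀_add, Ext.comp_add]
  map_smul' r f := by
    rw [RingHom.id_apply, ← Ext.comp_smul, ← Ext.mk₀_smul]
    rfl

/-- The next term of the long exact sequence is `Ext¹(R, R)`, which vanishes because `R` is
projective. -/
theorem connectingHom_surjective : Function.Surjective (connectingHom R) := by
  intro x
  obtain ⟨y, rfl⟩ := Ext.contravariant_sequence_exact₃ (residueSequence_shortExact R) _ x
    (Ext.eq_zero_of_projective _) (add_zero 1)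
  obtain ⟨f, rfl⟩ := Ext.homEquiv₀.symm.surjective y
  exact ⟨f.hom, rfl⟩

/-- By exactness the kernel consists of the maps that extend to `R → R`, and these are
multiplications. -/
theorem connectingHom_eq_zero_iff (h : maximalIdeal R →ₗ[R] R) :
    connectingHom R h = 0 ↔ ∃ r : R, ∀ x, h x = r * x := by
  constructor
  · intro h0
    obtain ⟨y, hy⟩ := Ext.contravariant_sequence_exact₁ (residueSequence_shortExact R) _
      (Ext.mk₀ (ModuleCat.ofHom h)) (add_zero 1) h0
    obtain ⟨f, rfl⟩ := Ext.homEquiv₀.symm.surjective y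
    have hf : (residueSequence R).f ≫ f = ModuleCat.ofHom h := by
      apply Ext.homEquiv₀.symm.injective
      simpa using hy
    refine ⟨f.hom (1 : R), fun x => ?_⟩
    have h1 : h x = f.hom (x : R) := by
      have := congrArg (fun g => g.hom x) hf
      exact this.symm
    rw [h1]
    have := f.hom.map_smul (x : R) (1 : R)
    simpa [mul_comm] using this
  · rintro ⟨r, hr⟩
    have : ModuleCat.ofHom h = (residueSequence R).f ≫ ModuleCat.ofHom (r • LinearMap.id) := by
      ext x
      exact hr x
    change (residueSequence_shortExact R).extClass.comp (Ext.mk₀ (ModuleCat.ofHom h)) rfl = 0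
    rw [this, ← Ext.mk₀_comp_mk₀, ShortComplex.ShortExact.extClass_comp_assoc]

theorem subsingleton_residueExt_zero [IsDomain R] (hR : maximalIdeal R ≠ ⊥) :
    Subsingleton (ResidueExt R 0) := by
  refine ⟨fun x y => ?_⟩
  obtain ⟨f, rfl⟩ := Ext.homEquiv₀.symm.surjective x
  obtain ⟨g, rfl⟩ := Ext.homEquiv₀.symm.surjective y
  obtain ⟨a, ha, ha0⟩ := Submodule.exists_mem_ne_zero_of_ne_bot hR
  have key : ∀ f : ModuleCat.of R (ResidueField R) ⟶ ModuleCat.of R R, f = 0 := by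
    intro f
    ext z
    have h1 : a • z = 0 := by
      obtain ⟨r, rfl⟩ := residue_surjective z
      rw [Algebra.smul_def]
      have : algebraMap R (ResidueField R) a = 0 := (residue_eq_zero_iff a).2 ha
      rw [this, zero_mul]
    have h2 : a * (f.hom z : R) = 0 := by
      have := f.hom.map_smul a z
      rw [h1, map_zero] at this
      exact this.symm
    exact (mul_eq_zero.1 h2).resolve_left ha0
  rw [key f, key g]

theorem localDepth_eq_one [IsDomain R] (hR : maximalIdeal R ≠ ⊥) {h : maximalIdeal R →ₗ[R] R}
    (hh : ¬ ∃ r : R, ∀ x, h x = r * x) : localDepth R = 1 := by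
  have h1 : Nontrivial (ResidueExt R 1) :=
    ⟨connectingHom R h, 0, fun h0 => hh ((connectingHom_eq_zero_iff R h).1 h0)⟩
  have h0 := subsingleton_residueExt_zero R hR
  apply le_antisymm
  · exact Nat.sInf_le h1
  · refine le_csInf ⟨1, h1⟩ fun i hi => ?_
    by_contra! h
    obtain rfl : i = 0 := by omega
    exact not_nontrivial_iff_subsingleton.2 h0 hi

end Ext

/-! ### Power series expansions on the monomial curve -/

namespace MonomialCurve

open NumSemigroup IsLocalRing
open scoped LaurentSeries PowerSeries

variable (k : Type u) [Field k] {e : ℕ} (n : Fin e → ℕ)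

section CoordinateRing

variable {k n}

theorem mem_coordinateRing_iff {p : Polynomial k} :
    p ∈ coordinateRing k n ↔ ∀ m ∉ numSemigroup n, p.coeff m = 0 := by
  constructor
  · intro hp
    induction hp using Algebra.adjoin_induction with
    | mem p hp =>
      obtain ⟨i, rfl⟩ := hp
      intro m hm
      rw [Polynomial.coeff_X_pow, if_neg]
      rintro rfl
      exact hm (gen_mem_numSemigroup i)
    | algebraMap r =>
      intro m hm
      rw [Polynomial.algebraMap_apply, Algebra.algebraMap_self_apply, Polynomial.coeff_C, if_neg]
      rintro rfl
      exact hm (zero_mem _)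
    | add p q _ _ hp hq =>
      intro m hm
      rw [Polynomial.coeff_add, hp m hm, hq m hm, add_zero]
    | mul p q _ _ hp hq =>
      intro m hm
      rw [Polynomial.coeff_mul]
      refine Finset.sum_eq_zero fun x hx => ?_
      rw [Finset.HasAntidiagonal.mem_antidiagonal] at hx
      by_cases h1 : x.1 ∈ numSemigroup n
      · rw [hq x.2 fun h2 => hm (hx ▸ add_mem h1 h2), mul_zero]
      · rw [hp x.1 h1, zero_mul]
  · intro hp
    have hX : ∀ s ∈ numSemigroup n, (Polynomial.X : Polynomial k) ^ s ∈ coordinateRing k n := by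
      intro s hs
      induction hs using AddSubmonoid.closure_induction with
      | mem x hx =>
        obtain ⟨i, rfl⟩ := hx
        exact Algebra.subset_adjoin ⟨i, rfl⟩
      | zero => rw [pow_zero]; exact one_mem _
      | add x y _ _ hx hy => rw [pow_add]; exact mul_mem hx hy
    rw [p.as_sum_support_C_mul_X_pow]
    refine sum_mem fun m hm => ?_
    rw [Polynomial.C_mul']
    refine Subalgebra.smul_mem _ (hX m ?_) _
    by_contra h
    exact Polynomial.mem_support_iff.1 hm (hp m h)

theorem mem_originIdeal_iff {a : coordinateRing k n} :
    a ∈ originIdeal k n ↔ (a : Polynomial k).coeff 0 = 0 := by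
  rw [originIdeal, RingHom.mem_ker]
  simp [Polynomial.constantCoeff_apply]

end CoordinateRing

/-- The inclusion of the coordinate ring into `k⟦t⟧`. -/
noncomputable def coordinateRingToPowerSeries : coordinateRing k n →+* k⟦X⟧ :=
  Polynomial.coeToPowerSeries.ringHom.comp (coordinateRing k n).toSubring.subtype

@[simp]
theorem coordinateRingToPowerSeries_apply (a : coordinateRing k n) :
    coordinateRingToPowerSeries k n a = ((a : Polynomial k) : k⟦X⟧) := rfl

theorem isUnit_coordinateRingToPowerSeries (y : (originIdeal k n).primeCompl) :
    IsUnit (coordinateRingToPowerSeries k n y) := by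
  rw [PowerSeries.isUnit_iff_constantCoeff, isUnit_iff_ne_zero]
  intro h
  refine y.2 (mem_originIdeal_iff.2 ?_)
  simpa using h

/-- The expansion at the origin of the elements of the local ring. -/
noncomputable def toPowerSeries : localRing k n →+* k⟦X⟧ :=
  IsLocalization.lift (M := (originIdeal k n).primeCompl)
    (isUnit_coordinateRingToPowerSeries k n)

@[simp]
theorem toPowerSeries_algebraMap (a : coordinateRing k n) :
    toPowerSeries k n (algebraMap _ _ a) = ((a : Polynomial k) : k⟦X⟧) :=
  IsLocalization.lift_eq _ a

theorem toPowerSeries_algebraMap_field (c : k) :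
    toPowerSeries k n (algebraMap _ _ c) = PowerSeries.C c := by
  rw [IsScalarTower.algebraMap_apply k (coordinateRing k n), toPowerSeries_algebraMap]
  simp

variable {k n}

theorem exists_mul_algebraMap (x : localRing k n) : ∃ a b : coordinateRing k n,
    (b : Polynomial k).coeff 0 ≠ 0 ∧ x * algebraMap _ _ b = algebraMap _ _ a := by
  obtain ⟨⟨a, b⟩, h⟩ := IsLocalization.surj (originIdeal k n).primeCompl x
  exact ⟨a, b, fun h0 => b.2 (mem_originIdeal_iff.2 h0), h⟩

theorem isUnit_algebraMap {b : coordinateRing k n} (hb : (b : Polynomial k).coeff 0 ≠ 0) :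
    IsUnit (algebraMap _ (localRing k n) b) :=
  IsLocalization.map_units (M := (originIdeal k n).primeCompl) _
    ⟨b, fun h => hb (mem_originIdeal_iff.1 h)⟩

instance localRing_isDomain : IsDomain (localRing k n) :=
  IsLocalization.isDomain_localization (originIdeal k n).primeCompl_le_nonZeroDivisors

theorem toPowerSeries_injective : Function.Injective (toPowerSeries k n) := by
  rw [injective_iff_map_eq_zero]
  intro x hx
  obtain ⟨a, b, hb, h⟩ := exists_mul_algebraMap x
  have h1 := congrArg (toPowerSeries k n) h
  rw [map_mul, hx, zero_mul, toPowerSeries_algebraMap] at h1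
  have h2 : (a : Polynomial k) = 0 := Polynomial.coe_eq_zero_iff.1 h1.symm
  rw [ZeroMemClass.coe_eq_zero] at h2
  rw [h2, map_zero] at h
  exact ((isUnit_algebraMap hb).mul_left_eq_zero).1 h

theorem mem_maximalIdeal_iff {x : localRing k n} :
    x ∈ maximalIdeal (localRing k n) ↔ PowerSeries.constantCoeff (toPowerSeries k n x) = 0 := by
  rw [mem_maximalIdeal, mem_nonunits_iff, not_iff_comm]
  constructor
  · intro h0
    obtain ⟨a, b, hb, h⟩ := exists_mul_algebraMap x
    have h1 := congrArg (fun y => PowerSeries.constantCoeff (toPowerSeries k n y)) h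
    simp only [map_mul, toPowerSeries_algebraMap, Polynomial.constantCoeff_coe] at h1
    have ha : (a : Polynomial k).coeff 0 ≠ 0 := by
      rw [← h1]
      exact mul_ne_zero h0 hb
    exact isUnit_of_mul_isUnit_left (h ▸ isUnit_algebraMap ha)
  · intro hx
    exact (((hx.map (toPowerSeries k n)).map PowerSeries.constantCoeff)).ne_zero

theorem coeff_toPowerSeries_eq_zero (x : localRing k n) {m : ℕ} (hm : m ∉ numSemigroup n) :
    PowerSeries.coeff m (toPowerSeries k n x) = 0 := by
  obtain ⟨a, b, hb, h⟩ := exists_mul_algebraMap x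
  replace h := congrArg (toPowerSeries k n) h
  simp only [map_mul, toPowerSeries_algebraMap] at h
  -- In the coefficient of `t ^ m` in `x * b = a`, a term with `b`-exponent in `S` and nonzero has
  -- `x`-exponent a smaller gap. Only `x_m * b_0` survives.
  induction m using Nat.strong_induction_on with
  | _ m ih =>
    have h1 := congrArg (PowerSeries.coeff m) h
    rw [PowerSeries.coeff_mul, Polynomial.coeff_coe, mem_coordinateRing_iff.1 a.2 m hm,
      Finset.sum_eq_single (m, 0)] at h1
    · rw [Polynomial.coeff_coe] at h1
      exact (mul_eq_zero.1 h1).resolve_right hb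
    · intro y hy hne
      rw [Finset.HasAntidiagonal.mem_antidiagonal] at hy
      rw [Polynomial.coeff_coe]
      by_cases h2 : y.2 ∈ numSemigroup n
      · rw [ih y.1, zero_mul]
        · have : y.2 ≠ 0 := fun h0 => hne (Prod.ext (by simpa [h0] using hy) h0)
          omega
        · exact fun h1 => hm (hy ▸ add_mem h1 h2)
      · rw [mem_coordinateRing_iff.1 b.2 _ h2, mul_zero]
    · simp

/-- A polynomial with nonzero constant term is invertible modulo `t ^ N`. -/
theorem exists_mul_coeff_eq {q : Polynomial k} (hq : q.coeff 0 ≠ 0) (N : ℕ) :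
    ∃ w : Polynomial k, ∀ m < N, (q * w).coeff m = if m = 0 then 1 else 0 := by
  refine ⟨PowerSeries.trunc N (q : k⟦X⟧)⁻¹, fun m hm => ?_⟩
  have h1 : (q : k⟦X⟧) * (q : k⟦X⟧)⁻¹ = 1 := PowerSeries.mul_inv_cancel _ (by simpa using hq)
  have h2 := congrArg (PowerSeries.coeff m) h1
  rw [PowerSeries.coeff_mul, PowerSeries.coeff_one] at h2
  rw [Polynomial.coeff_mul, ← h2]
  refine Finset.sum_congr rfl fun x hx => ?_
  rw [Finset.HasAntidiagonal.mem_antidiagonal] at hx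
  rw [PowerSeries.coeff_trunc, if_pos (by omega), Polynomial.coeff_coe]

/-- A quotient of two elements of the local ring whose expansion is a power series supported in the
semigroup is an element of the local ring. -/
theorem exists_toPowerSeries_eq (hS : ∃ N, ∀ m ≥ N, m ∈ numSemigroup n) {x y : localRing k n}
    (hy : y ≠ 0) {f : k⟦X⟧} (hfS : ∀ m ∉ numSemigroup n, PowerSeries.coeff m f = 0)
    (hf : f * toPowerSeries k n y = toPowerSeries k n x) : ∃ r, toPowerSeries k n r = f := by
  obtain ⟨N, hN⟩ := hS
  obtain ⟨p, q, hq, h1⟩ : ∃ p q : Polynomial k, q ≠ 0 ∧ f * (q : k⟦X⟧) = (p : k⟦X⟧) := by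
    obtain ⟨a, b, hb, hab⟩ := exists_mul_algebraMap x
    obtain ⟨c, d, hd, hcd⟩ := exists_mul_algebraMap y
    refine ⟨a * d, c * b, mul_ne_zero ?_ fun h0 => hb (by simp [h0]), ?_⟩
    · intro h0
      rw [ZeroMemClass.coe_eq_zero] at h0
      rw [h0, map_zero] at hcd
      exact hy (((isUnit_algebraMap hd).mul_left_eq_zero).1 hcd)
    · replace hab := congrArg (toPowerSeries k n) hab
      replace hcd := congrArg (toPowerSeries k n) hcd
      simp only [map_mul, toPowerSeries_algebraMap] at hab hcd
      push_cast
      rw [← hab, ← hcd, ← hf]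
      ring
  -- Cancelling the power of `t` in `q`, which also divides `p` as `f` is a power series, leaves a
  -- denominator with nonzero constant term.
  obtain ⟨q', hqq', hq'⟩ := Polynomial.exists_eq_pow_rootMultiplicity_mul_and_not_dvd _ hq 0
  set m := Polynomial.rootMultiplicity 0 q
  rw [Polynomial.C_0, sub_zero] at hqq' hq'
  rw [Polynomial.X_dvd_iff] at hq'
  obtain ⟨p', hp'⟩ : (Polynomial.X : Polynomial k) ^ m ∣ p := by
    have : (PowerSeries.X : k⟦X⟧) ^ m ∣ (p : k⟦X⟧) := by
      rw [← h1, hqq', Polynomial.coe_mul, Polynomial.coe_pow, Polynomial.coe_X]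
      exact (dvd_mul_right _ _).mul_left _
    rw [PowerSeries.X_pow_dvd_iff] at this
    exact Polynomial.X_pow_dvd_iff.2 fun d hd => by simpa using this d hd
  have h2 : f * (q' : k⟦X⟧) = (p' : k⟦X⟧) := by
    rw [hqq', hp'] at h1
    push_cast at h1
    have hX : (PowerSeries.X : k⟦X⟧) ^ m ≠ 0 := pow_ne_zero _ PowerSeries.X_ne_zero
    exact mul_left_cancel₀ hX (by linear_combination h1)
  -- Making the denominator `1` modulo `t ^ (N + 1)` puts it in the coordinate ring, as all gaps are
  -- below `N`; the numerator follows since `f` is supported in `S`. The bound `N + 1` covers the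
  -- constant term even for `N = 0`.
  obtain ⟨w, hw⟩ := exists_mul_coeff_eq hq' (N + 1)
  have hbA : q' * w ∈ coordinateRing k n := mem_coordinateRing_iff.2 fun i hi => by
    have : i < N := by by_contra h; exact hi (hN i (by omega))
    rw [hw i (by omega), if_neg]
    rintro rfl
    exact hi (zero_mem _)
  have h3 : f * ((q' * w : Polynomial k) : k⟦X⟧) = ((p' * w : Polynomial k) : k⟦X⟧) := by
    push_cast
    rw [← h2]; ring
  have haA : p' * w ∈ coordinateRing k n := mem_coordinateRing_iff.2 fun i hi => by
    rw [← Polynomial.coeff_coe, ← h3, PowerSeries.coeff_mul]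
    refine Finset.sum_eq_zero fun x hx => ?_
    rw [Finset.HasAntidiagonal.mem_antidiagonal] at hx
    by_cases hx1 : x.1 ∈ numSemigroup n
    · rw [Polynomial.coeff_coe, mem_coordinateRing_iff.1 hbA, mul_zero]
      exact fun hx2 => hi (hx ▸ add_mem hx1 hx2)
    · rw [hfS _ hx1, zero_mul]
  have hb0 : (q' * w).coeff 0 ≠ 0 := by rw [hw 0 (by omega)]; simp
  obtain ⟨b, hb⟩ := isUnit_algebraMap (b := ⟨q' * w, hbA⟩) hb0
  refine ⟨algebraMap _ _ (⟨p' * w, haA⟩ : coordinateRing k n) * (b⁻¹ : (localRing k n)ˣ), ?_⟩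
  have h4 : toPowerSeries k n b = ((q' * w : Polynomial k) : k⟦X⟧) := by
    rw [hb, toPowerSeries_algebraMap]
  rw [map_mul, toPowerSeries_algebraMap, ← h3, ← h4, mul_assoc, ← map_mul, Units.mul_inv, map_one,
    mul_one]

theorem exists_toPowerSeries_eq_X_pow {s : ℕ} (hs : s ∈ numSemigroup n) :
    ∃ r, toPowerSeries k n r = PowerSeries.X ^ s := by
  have : (Polynomial.X : Polynomial k) ^ s ∈ coordinateRing k n :=
    mem_coordinateRing_iff.2 fun m hm => by
      rw [Polynomial.coeff_X_pow, if_neg]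
      rintro rfl
      exact hm hs
  exact ⟨algebraMap _ _ (⟨_, this⟩ : coordinateRing k n), by simp⟩

end MonomialCurve

/-! ### Local rings with expansions supported in a semigroup -/

open NumSemigroup IsLocalRing
open scoped LaurentSeries PowerSeries

/-- `ψ` identifies the local ring `R` with the ring of those fractions of elements of `R` whose
expansions in `k⟦t⟧` are supported in the numerical semigroup `S`. -/
structure IsSemigroupExpansion {k R : Type u} [Field k] [CommRing R] [IsLocalRing R] [Algebra k R]
    (S : AddSubmonoid ℕ) (ψ : R →+* k⟦X⟧) : Prop where
  injective : Function.Injective ψ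
  map_algebraMap : ∀ c : k, ψ (algebraMap k R c) = PowerSeries.C c
  mem_maximalIdeal_iff : ∀ x, x ∈ maximalIdeal R ↔ PowerSeries.constantCoeff (ψ x) = 0
  coeff_eq_zero : ∀ x, ∀ m ∉ S, PowerSeries.coeff m (ψ x) = 0
  exists_eq_X_pow : ∀ s ∈ S, ∃ r, ψ r = PowerSeries.X ^ s
  exists_eq : ∀ (x y : R) (f : k⟦X⟧), y ≠ 0 → (∀ m ∉ S, PowerSeries.coeff m f = 0) →
    f * ψ y = ψ x → ∃ r, ψ r = f

theorem MonomialCurve.isSemigroupExpansion (k : Type u) [Field k] {e : ℕ} {n : Fin e → ℕ}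
    (hS : ∃ N, ∀ m ≥ N, m ∈ numSemigroup n) :
    IsSemigroupExpansion (R := MonomialCurve.localRing k n) (numSemigroup n)
      (MonomialCurve.toPowerSeries k n) where
  injective := toPowerSeries_injective
  map_algebraMap := toPowerSeries_algebraMap_field k n
  mem_maximalIdeal_iff _ := MonomialCurve.mem_maximalIdeal_iff
  coeff_eq_zero x _ hm := coeff_toPowerSeries_eq_zero x hm
  exists_eq_X_pow _ hs := exists_toPowerSeries_eq_X_pow hs
  exists_eq _ _ _ hy hf h := exists_toPowerSeries_eq hS hy hf h

section PowerSeries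

variable {k : Type u} [Field k]

theorem coeff_ofPowerSeries_of_neg (f : k⟦X⟧) {z : ℤ} (hz : z < 0) :
    (HahnSeries.ofPowerSeries ℤ k f).coeff z = 0 := by
  rw [PowerSeries.coeff_coe, if_pos hz]

theorem exists_ofPowerSeries_eq {f : k⸨X⸩} (hf : ∀ z < 0, f.coeff z = 0) :
    ∃ g : k⟦X⟧, HahnSeries.ofPowerSeries ℤ k g = f := by
  refine ⟨PowerSeries.mk fun m => f.coeff m, ?_⟩
  ext z
  rcases lt_or_ge z 0 with h | h
  · rw [coeff_ofPowerSeries_of_neg _ h, hf z h]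
  · lift z to ℕ using h
    rw [LaurentSeries.coeff_coe_powerSeries, PowerSeries.coeff_mk]

/-- Orders of vanishing add up under multiplication. -/
theorem coeff_ofPowerSeries_mul_eq_zero {f g : k⟦X⟧} {F : ℤ}
    (hf : ∀ z ≤ F, (HahnSeries.ofPowerSeries ℤ k f).coeff z = 0) {z : ℤ} (hz : z ≤ F) :
    (HahnSeries.ofPowerSeries ℤ k f * HahnSeries.ofPowerSeries ℤ k g).coeff z = 0 := by
  rw [← map_mul]
  rcases lt_or_ge z 0 with h | h
  · exact coeff_ofPowerSeries_of_neg _ h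
  lift z to ℕ using h
  rw [LaurentSeries.coeff_coe_powerSeries, PowerSeries.coeff_mul]
  refine Finset.sum_eq_zero fun x hx => ?_
  rw [Finset.HasAntidiagonal.mem_antidiagonal] at hx
  have := hf x.1 (by omega)
  rw [LaurentSeries.coeff_coe_powerSeries] at this
  rw [this, zero_mul]

end PowerSeries

/-! ### Lengths and type in terms of the semigroup -/

namespace IsSemigroupExpansion

variable {k R : Type u} [Field k] [CommRing R] [IsLocalRing R] [Algebra k R]
  {S : AddSubmonoid ℕ} {ψ : R →+* k⟦X⟧}

theorem coeff_ofPowerSeries_eq_zero (h : IsSemigroupExpansion S ψ) (x : R) {z : ℤ}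
    (hz : z ∉ intSet S) : (HahnSeries.ofPowerSeries ℤ k (ψ x)).coeff z = 0 := by
  rcases lt_or_ge z 0 with hz0 | hz0
  · exact coeff_ofPowerSeries_of_neg _ hz0
  · lift z to ℕ using hz0
    rw [LaurentSeries.coeff_coe_powerSeries]
    exact h.coeff_eq_zero x _ fun h => hz (natCast_mem_intSet.2 h)

theorem algebraMap_residueField_surjective (h : IsSemigroupExpansion S ψ) :
    Function.Surjective (algebraMap k (ResidueField R)) := by
  intro y
  obtain ⟨x, rfl⟩ := residue_surjective y
  refine ⟨PowerSeries.constantCoeff (ψ x), ?_⟩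
  rw [IsScalarTower.algebraMap_apply k R, ResidueField.algebraMap_eq, ← sub_eq_zero,
    ← map_sub, residue_eq_zero_iff, h.mem_maximalIdeal_iff, map_sub, map_sub,
    h.map_algebraMap]
  simp

theorem exists_mem_maximalIdeal_eq_X_pow (h : IsSemigroupExpansion S ψ) {s : ℕ} (hs : s ∈ S)
    (hs0 : s ≠ 0) : ∃ x : maximalIdeal R, ψ x = PowerSeries.X ^ s := by
  obtain ⟨x, hx⟩ := h.exists_eq_X_pow s hs
  exact ⟨⟨x, by rw [h.mem_maximalIdeal_iff, hx]; simp [hs0]⟩, hx⟩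

variable [IsDomain R]

/-- The extension of an expansion to the field of fractions. -/
noncomputable def toLaurentSeries (h : IsSemigroupExpansion S ψ) : FractionRing R →+* k⸨X⸩ :=
  IsFractionRing.lift (A := R) (g := (HahnSeries.ofPowerSeries ℤ k).comp ψ)
    (HahnSeries.ofPowerSeries_injective.comp h.injective)

variable (h : IsSemigroupExpansion S ψ)

@[simp]
theorem toLaurentSeries_algebraMap (x : R) :
    h.toLaurentSeries (algebraMap R (FractionRing R) x) = HahnSeries.ofPowerSeries ℤ k (ψ x) :=
  IsFractionRing.lift_algebraMap _ x

theorem toLaurentSeries_injective : Function.Injective h.toLaurentSeries :=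
  h.toLaurentSeries.injective

theorem toLaurentSeries_smul (c : k) (v : FractionRing R) :
    h.toLaurentSeries (c • v) = c • h.toLaurentSeries v := by
  rw [Algebra.smul_def, map_mul, IsScalarTower.algebraMap_apply k R,
    toLaurentSeries_algebraMap, h.map_algebraMap, HahnSeries.ofPowerSeries_C,
    HahnSeries.C_mul_eq_smul]

theorem exists_algebraMap_eq {v : FractionRing R}
    (hv : ∀ z ∉ intSet S, (h.toLaurentSeries v).coeff z = 0) :
    ∃ r : R, algebraMap R (FractionRing R) r = v := by
  obtain ⟨f, hf⟩ := exists_ofPowerSeries_eq (f := h.toLaurentSeries v) fun z hz =>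
    hv z fun h => absurd (nonneg_of_mem_intSet h) (not_le.2 hz)
  obtain ⟨⟨x, y⟩, hxy⟩ := IsLocalization.surj (nonZeroDivisors R) v
  obtain ⟨r, hr⟩ := h.exists_eq x y f (nonZeroDivisors.coe_ne_zero y)
    (fun m hm => by
      rw [← LaurentSeries.coeff_coe_powerSeries, hf]
      exact hv _ fun h => hm (natCast_mem_intSet.1 h))
    (by
      have := congrArg h.toLaurentSeries hxy
      rw [map_mul, ← hf, toLaurentSeries_algebraMap, toLaurentSeries_algebraMap, ← map_mul] at this
      exact HahnSeries.ofPowerSeries_injective this)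
  exact ⟨r, h.toLaurentSeries_injective (by rw [toLaurentSeries_algebraMap, hr, hf])⟩

/-- Holds because `k⟦t⟧` is integrally closed in `k⸨t⸩`. -/
theorem exists_ofPowerSeries_eq_of_isIntegral {v : FractionRing R} (hv : IsIntegral R v) :
    ∃ f : k⟦X⟧, HahnSeries.ofPowerSeries ℤ k f = h.toLaurentSeries v := by
  have h1 : IsIntegral k⟦X⟧ (h.toLaurentSeries v) :=
    hv.map_of_comp_eq ψ h.toLaurentSeries (by ext x; simp)
  exact IsIntegrallyClosed.isIntegral_iff.1 h1

theorem exists_toLaurentSeries_eq_single (hS : ∃ N, ∀ m ≥ N, m ∈ S) (z : ℤ) :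
    ∃ v : FractionRing R, h.toLaurentSeries v = HahnSeries.single z 1 := by
  obtain ⟨N, hN⟩ := hS
  obtain ⟨a, ha⟩ := h.exists_eq_X_pow (N + z.natAbs) (hN _ (by omega))
  -- `t ^ z` is a quotient of two powers whose exponents are both at least `N`, hence in `S`.
  obtain ⟨b, hb⟩ := h.exists_eq_X_pow (N + z.natAbs - z).toNat (hN _ (by omega))
  refine ⟨algebraMap _ _ a / algebraMap _ _ b, ?_⟩
  rw [map_div₀, toLaurentSeries_algebraMap, toLaurentSeries_algebraMap, ha, hb,
    HahnSeries.ofPowerSeries_X_pow, HahnSeries.ofPowerSeries_X_pow, div_eq_iff,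
    HahnSeries.single_mul_single, one_mul]
  · have hz : ((N + z.natAbs : ℕ) : ℤ) = z + ((N + z.natAbs - z).toNat : ℕ) := by omega
    rw [hz]
  · exact HahnSeries.single_ne_zero one_ne_zero

theorem isIntegral_of_toLaurentSeries_eq_single (hS : ∃ N, ∀ m ≥ N, m ∈ S) {v : FractionRing R}
    {g : ℕ} (hv : h.toLaurentSeries v = HahnSeries.single (g : ℤ) 1) : IsIntegral R v := by
  obtain ⟨N, hN⟩ := hS
  obtain ⟨r, hr⟩ := h.exists_eq_X_pow ((N + 1) * g) (by
    rw [mul_comm, ← smul_eq_mul]; exact S.nsmul_mem (hN _ (by omega)) _)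
  refine IsIntegral.of_pow (n := N + 1) (by omega) ?_
  have : v ^ (N + 1) = algebraMap _ _ r := by
    apply h.toLaurentSeries_injective
    rw [map_pow, hv, toLaurentSeries_algebraMap, hr, HahnSeries.ofPowerSeries_X_pow,
      HahnSeries.single_pow]
    simp
  rw [this]
  exact isIntegral_algebraMap

/-- The coefficients at a set of exponents, as a linear map. -/
noncomputable def coeffs (ι : Set ℤ) : FractionRing R →ₗ[k] (ι → k) where
  toFun v z := (h.toLaurentSeries v).coeff z
  map_add' v w := by ext z; simp
  map_smul' c v := by ext z; simp [toLaurentSeries_smul]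

@[simp]
theorem coeffs_apply (ι : Set ℤ) (v : FractionRing R) (z : ι) :
    h.coeffs ι v z = (h.toLaurentSeries v).coeff z := rfl

/-- The coefficients at the gaps vanish on `R`, and take arbitrary values on `R̄` since each `t ^ g`
is integral over `R`. -/
theorem encard_gaps_le_length (h : IsSemigroupExpansion S ψ) (hS : ∃ N, ∀ m ≥ N, m ∈ S) :
    {g : ℕ | g ∉ S}.encard ≤ Module.length R (NormalizationQuotient R) := by
  classical
  let G : Set ℤ := (fun a : ℕ => (a : ℤ)) '' {g : ℕ | g ∉ S}
  have hGc : G.encard = {g : ℕ | g ∉ S}.encard :=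
    Function.Injective.encard_image Nat.cast_injective _
  have hGfin : Finite G := (finite_gaps hS).image _
  let N := LinearMap.range (Algebra.linearMap R (Normalization R))
  let c : Normalization R →ₗ[k] (G → k) :=
    (h.coeffs G).comp ((integralClosure R (FractionRing R)).val.toLinearMap.restrictScalars k)
  let p : (Normalization R ⧸ N.restrictScalars k) →ₗ[k] (G → k) :=
    (N.restrictScalars k).liftQ c (by
      rintro _ ⟨r, rfl⟩
      ext ⟨_, g, hg, rfl⟩
      change (h.toLaurentSeries (algebraMap R (FractionRing R) r)).coeff (g : ℤ) = 0
      rw [toLaurentSeries_algebraMap]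
      exact h.coeff_ofPowerSeries_eq_zero r fun hm => hg (natCast_mem_intSet.1 hm))
  have hp : Function.Surjective p := by
    rw [← LinearMap.range_eq_top, eq_top_iff, ← (Pi.basisFun k G).span_eq, Submodule.span_le]
    rintro _ ⟨⟨_, g, hg, rfl⟩, rfl⟩
    obtain ⟨v, hv⟩ := h.exists_toLaurentSeries_eq_single hS g
    refine ⟨Submodule.Quotient.mk ⟨v, h.isIntegral_of_toLaurentSeries_eq_single hS hv⟩, ?_⟩
    ext ⟨z, hz⟩
    change (h.toLaurentSeries v).coeff z = _
    rw [hv, Pi.basisFun_apply, HahnSeries.coeff_single, Pi.single_apply]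
    by_cases hzg : z = g
    · rw [if_pos hzg, if_pos (Subtype.ext hzg)]
    · rw [if_neg hzg, if_neg fun h0 => hzg (congrArg Subtype.val h0)]
  calc {g : ℕ | g ∉ S}.encard = Module.length k (G → k) := by
        have h1 : Module.length k k = 1 := Module.length_eq_one k k
        rw [Module.length_pi, h1, mul_one, ← hGc]
        rfl
    _ ≤ Module.length k (Normalization R ⧸ N.restrictScalars k) := Module.length_le_of_surjective p hp
    _ = Module.length k (NormalizationQuotient R) :=
        (Submodule.Quotient.restrictScalarsEquiv k N).length_eq
    _ ≤ _ := length_le_length_of_residueField h.algebraMap_residueField_surjective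

/-- Multiplying an element of `R̄`, a power series, by one of order greater than `F` gives a series
without terms at gaps. -/
theorem mem_conductorIdeal (h : IsSemigroupExpansion S ψ) (hS : ∃ N, ∀ m ≥ N, m ∈ S) {x : R}
    (hx : ∀ z ≤ frobenius S, (HahnSeries.ofPowerSeries ℤ k (ψ x)).coeff z = 0) :
    x ∈ conductorIdeal R := by
  rw [conductorIdeal, Module.mem_annihilator]
  intro y
  obtain ⟨v, rfl⟩ := Submodule.Quotient.mk_surjective _ y
  obtain ⟨f, hf⟩ := h.exists_ofPowerSeries_eq_of_isIntegral v.2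
  obtain ⟨r, hr⟩ := h.exists_algebraMap_eq (v := x • (v : FractionRing R)) fun z hz => by
    rw [Algebra.smul_def, map_mul, toLaurentSeries_algebraMap, ← hf]
    exact coeff_ofPowerSeries_mul_eq_zero hx ((isGreatest_frobenius hS).2 hz)
  rw [← Submodule.Quotient.mk_smul, Submodule.Quotient.mk_eq_zero]
  exact ⟨r, Subtype.ext hr⟩

theorem length_quotient_conductorIdeal_le (h : IsSemigroupExpansion S ψ) (hS : ∃ N, ∀ m ≥ N, m ∈ S) :
    Module.length R (R ⧸ conductorIdeal R) ≤ {s : ℕ | s ∈ S ∧ (s : ℤ) < frobenius S}.encard := by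
  let A : Set ℤ := (fun a : ℕ => (a : ℤ)) '' {s : ℕ | s ∈ S ∧ (s : ℤ) < frobenius S}
  have hAc : A.encard = {s : ℕ | s ∈ S ∧ (s : ℤ) < frobenius S}.encard :=
    Function.Injective.encard_image Nat.cast_injective _
  have h1 : Module.length k (A → k) = {s : ℕ | s ∈ S ∧ (s : ℤ) < frobenius S}.encard := by
    have h1 : Module.length k k = 1 := Module.length_eq_one k k
    rw [Module.length_pi, h1, mul_one, ← hAc]
    rfl
  rw [← h1]
  refine length_le_length_of_ker_le (Submodule.mkQ (conductorIdeal R)) (Submodule.mkQ_surjective _)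
    ((h.coeffs A).comp ((Algebra.linearMap R (FractionRing R)).restrictScalars k)) ?_
  intro x hx
  rw [Submodule.mkQ_apply, Submodule.Quotient.mk_eq_zero]
  refine h.mem_conductorIdeal hS fun z hz => ?_
  by_cases hzS : z ∈ intSet S
  · have hzF : z ≠ frobenius S := fun h0 => frobenius_notMem hS (h0 ▸ hzS)
    obtain ⟨s, hs, rfl⟩ := hzS
    have := congrFun hx ⟨_, s, ⟨hs, lt_of_le_of_ne hz hzF⟩, rfl⟩
    simpa using this
  · exact h.coeff_ofPowerSeries_eq_zero x hzS

/-- If the coefficients of `φ (t ^ s₀)` at the exponents `f + s₀`, `f` a pseudo-Frobenius number,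
vanish, then the homomorphism `φ : 𝔪 → R` is a multiplication by an element of `R`. -/
theorem exists_eq_mul_of_coeff_eq_zero (h : IsSemigroupExpansion S ψ) (φ : maximalIdeal R →ₗ[R] R) {s₀ : ℕ}
    {x₀ : maximalIdeal R} (hx₀ : ψ x₀ = PowerSeries.X ^ s₀)
    (hφ : ∀ f ∈ pseudoFrobenius S, (HahnSeries.ofPowerSeries ℤ k (ψ (φ x₀))).coeff (f + s₀) = 0) :
    ∃ r : R, ∀ x, φ x = r * x := by
  have hx0 : (x₀ : R) ≠ 0 := by
    intro h0
    rw [h0, map_zero] at hx₀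
    exact pow_ne_zero _ PowerSeries.X_ne_zero hx₀.symm
  have hx0' : algebraMap R (FractionRing R) x₀ ≠ 0 := by
    simpa using hx0
  let v : FractionRing R := algebraMap _ _ (φ x₀) / algebraMap _ _ (x₀ : R)
  have hv : ∀ x : maximalIdeal R,
      algebraMap R (FractionRing R) (φ x) = v * algebraMap _ _ (x : R) := by
    intro x
    have h1 : (x₀ : R) * φ x = x * φ x₀ := by
      rw [← smul_eq_mul, ← smul_eq_mul, ← map_smul, ← map_smul]
      congr 1
      ext
      simp [mul_comm]
    have h2 := congrArg (algebraMap R (FractionRing R)) h1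
    rw [map_mul, map_mul] at h2
    simp only [v]
    field_simp
    linear_combination h2
  have hcoeff : ∀ (s : ℕ) (x : maximalIdeal R), ψ x = PowerSeries.X ^ s → ∀ z,
      (h.toLaurentSeries v).coeff z = (HahnSeries.ofPowerSeries ℤ k (ψ (φ x))).coeff (z + s) := by
    intro s x hx z
    rw [← h.toLaurentSeries_algebraMap, hv, map_mul, toLaurentSeries_algebraMap, hx,
      HahnSeries.ofPowerSeries_X_pow, HahnSeries.coeff_mul_single_add, mul_one]
  -- `φ` is multiplication by the fraction `v`, so it remains to see that `v` has no terms outside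
  -- `S`. At a `z ∉ S` that is not pseudo-Frobenius, some `z + s` is still outside `S`, and the
  -- coefficient reappears there in `φ (t ^ s)`.
  obtain ⟨r, hr⟩ := h.exists_algebraMap_eq (v := v) fun z hz => by
    by_cases hzP : z ∈ pseudoFrobenius S
    · rw [hcoeff s₀ x₀ hx₀]
      exact hφ z hzP
    · obtain ⟨s, hs, hs0, hzs⟩ : ∃ s ∈ S, s ≠ 0 ∧ z + (s : ℤ) ∉ intSet S := by
        by_contra! hcon
        exact hzP ⟨hz, hcon⟩
      obtain ⟨x, hx⟩ := h.exists_eq_X_pow s hs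
      have hxm : x ∈ maximalIdeal R := by
        rw [h.mem_maximalIdeal_iff, hx]
        simp [hs0]
      rw [hcoeff s ⟨x, hxm⟩ hx]
      exact h.coeff_ofPowerSeries_eq_zero _ hzs
  refine ⟨r, fun x => IsFractionRing.injective R (FractionRing R) ?_⟩
  rw [hv, map_mul, hr]

/-- Multiplication by `t ^ F`, `F` the Frobenius number. -/
theorem exists_hom_ne_mul (h : IsSemigroupExpansion S ψ) (hS : ∃ N, ∀ m ≥ N, m ∈ S) :
    ∃ φ : maximalIdeal R →ₗ[R] R, ¬ ∃ r : R, ∀ x, φ x = r * x := by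
  obtain ⟨v, hv⟩ := h.exists_toLaurentSeries_eq_single hS (frobenius S)
  have hmem : ∀ x : maximalIdeal R,
      ∃ r : R, algebraMap R (FractionRing R) r = v * algebraMap _ _ (x : R) := by
    intro x
    refine h.exists_algebraMap_eq fun z hz => ?_
    rw [map_mul, hv, HahnSeries.coeff_single_mul, one_mul, toLaurentSeries_algebraMap]
    -- A term of `t ^ F * x` at a gap `z ≤ F` comes from a term of `x` of exponent `z - F ≤ 0`;
    -- there is none, as `x ∈ 𝔪`.
    have hzF : z - frobenius S ≤ 0 := sub_nonpos.2 ((isGreatest_frobenius hS).2 hz)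
    rcases hzF.lt_or_eq with h0 | h0
    · exact coeff_ofPowerSeries_of_neg _ h0
    · rw [h0, ← Nat.cast_zero, LaurentSeries.coeff_coe_powerSeries]
      simpa using (h.mem_maximalIdeal_iff _).1 x.2
  choose φ hφ using hmem
  have hinj := IsFractionRing.injective R (FractionRing R)
  refine ⟨{ toFun := φ, map_add' := fun x y => hinj ?_, map_smul' := fun r x => hinj ?_ }, ?_⟩
  · simp [hφ, mul_add]
  · simp [hφ, mul_left_comm]
  · rintro ⟨r, hr⟩
    obtain ⟨N, hN⟩ := id hS
    obtain ⟨x, hx⟩ := h.exists_mem_maximalIdeal_eq_X_pow (hN (N + 1) (by omega)) (by omega)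
    have hx0 : h.toLaurentSeries (algebraMap R (FractionRing R) (x : R)) ≠ 0 := by
      rw [toLaurentSeries_algebraMap, hx, HahnSeries.ofPowerSeries_X_pow]
      exact HahnSeries.single_ne_zero one_ne_zero
    have h1 : φ x = r * x := hr x
    have h2 := hφ x
    rw [h1, map_mul] at h2
    have h3 := congrArg h.toLaurentSeries h2
    rw [map_mul, map_mul, hv] at h3
    have h4 := congrArg (fun f => f.coeff (frobenius S)) (mul_right_cancel₀ hx0 h3)
    simp only [toLaurentSeries_algebraMap, HahnSeries.coeff_single_same] at h4
    rw [h.coeff_ofPowerSeries_eq_zero r (frobenius_notMem hS)] at h4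
    exact zero_ne_one h4

theorem maximalIdeal_ne_bot (h : IsSemigroupExpansion S ψ) (hS : ∃ N, ∀ m ≥ N, m ∈ S) :
    maximalIdeal R ≠ ⊥ := by
  obtain ⟨φ, hφ⟩ := h.exists_hom_ne_mul hS
  intro h0
  refine hφ ⟨0, fun x => ?_⟩
  have : x = 0 := Subtype.ext (by simpa [h0] using x.2)
  simp [this]

/-- The depth is one, so the type is the length of `Ext¹(κ, R)`. A map `φ : 𝔪 → R` has zero class as
soon as `φ (t ^ (N + 1))` has zero coefficients at the exponents `f + N + 1`, `f` pseudo-Frobenius;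
this is at most `t(S)` linear conditions over `k`. -/
theorem cohenMacaulayType_le (h : IsSemigroupExpansion S ψ) (hS : ∃ N, ∀ m ≥ N, m ∈ S) : cohenMacaulayType R ≤ type S := by
  obtain ⟨φ, hφ⟩ := h.exists_hom_ne_mul hS
  rw [cohenMacaulayType, localDepth_eq_one R (h.maximalIdeal_ne_bot hS) hφ]
  obtain ⟨N, hN⟩ := id hS
  obtain ⟨x, hx⟩ := h.exists_mem_maximalIdeal_eq_X_pow (hN (N + 1) (by omega)) (by omega)
  let P : Set ℤ := (fun f => f + ((N + 1 : ℕ) : ℤ)) '' pseudoFrobenius S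
  have hPc : P.encard = type S :=
    Function.Injective.encard_image (add_left_injective _) _
  have h1 : Module.length k (P → k) = type S := by
    have h1 : Module.length k k = 1 := Module.length_eq_one k k
    rw [Module.length_pi, h1, mul_one, ← hPc]
    rfl
  rw [← h1]
  refine length_le_length_of_ker_le (connectingHom R) (connectingHom_surjective R)
    (((h.coeffs P).comp ((Algebra.linearMap R (FractionRing R)).restrictScalars k)).comp
      ((LinearMap.applyₗ x).restrictScalars k)) ?_
  intro φ hφ
  rw [connectingHom_eq_zero_iff]
  refine h.exists_eq_mul_of_coeff_eq_zero φ hx fun f hf => ?_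
  have := congrFun hφ ⟨_, f, hf, rfl⟩
  simpa using this

theorem isAlmostSymmetric (h : IsSemigroupExpansion S ψ) (hS : ∃ N, ∀ m ≥ N, m ∈ S) (hR : IsAlmostGorenstein R) :
    IsAlmostSymmetric S := by
  refine isAlmostSymmetric_of_encard_gaps_le hS ?_
  refine (add_le_add_left (h.encard_gaps_le_length hS) 1).trans ?_
  rw [hR]
  exact add_le_add (h.length_quotient_conductorIdeal_le hS) (h.cohenMacaulayType_le hS)

end IsSemigroupExpansion

theorem theorem1 (n : Fin 4 → ℕ) (hgcd : Finset.univ.gcd n = 1) (hmin : IsMinimalGenSystem n) :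
    (∀ (k : Type u) [Field k], IsAlmostGorenstein (MonomialCurve.localRing k n) →
      cohenMacaulayType (MonomialCurve.localRing k n) ≤ 3) ∧
    (NumSemigroup.IsAlmostSymmetric (numSemigroup n) →
      NumSemigroup.type (numSemigroup n) ≤ 3) := by
  have hS := exists_forall_ge_mem_numSemigroup hgcd
  refine ⟨fun k _ hR => ?_, IsAlmostSymmetric.type_le_three hgcd hmin⟩
  have h := MonomialCurve.isSemigroupExpansion k hS
  exact (h.cohenMacaulayType_le hS).trans ((h.isAlmostSymmetric hS hR).type_le_three hgcd hmin)
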